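/- Let $d\ge 2$ and let $|\cdot|$ be the $\ell^1$-norm on $\mathbb Z^d$; connectedness refers to the nearest-neighbour graph, and $\mathrm{dist}$ to $|\cdot|$. For finite nonempty $A\subset\mathbb Z^d$ put $\mathrm{diam}(A)=\max\{1,\max_{x,y\in A}|x-y|\}$ (so a point has diameter $1$). For $A\subset\mathbb Z^d$ finite let $A^{(0)}$ be the unbounded connected component of $A^c$, $V(A)=(A^{(0)})^c$, and let $\partial_{\mathrm{in}}A$ be the set of points of $A$ with a nearest neighbour in $A^c$. For $\sigma\in\{-1,+1\}^{\mathbb Z^d}$ the boundary $\partial\sigma$ is the set of $x$ such that $\sigma$ is not constant on $\{y:|x-y|\le1\}$. Let $M,a>0$ be real and $r\ge1$ an integer. If $\partial\sigma$ is finite, an $(M,a,r)$-partition is a partition $\Gamma$ of $\partial\sigma$ into nonempty sets such that (A) for distinct $\overline\gamma,\overline\gamma'\in\Gamma$ the set $\overline\gamma'$ is contained in a single connected component of $\overline\gamma^{\,c}$, and (B) every $\overline\gamma\in\Gamma$ can be written as a union $\overline\gamma=\bigcup_{k=1}^{n}\overline\gamma_k$ with $1\le n\le 2^r-1$ ($n$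 depending on $\overline\gamma$) in such a way that for all distinct $\overline\gamma,\overline\gamma'\in\Gamma$ $$\mathrm{dist}(\overline\gamma,\overline\gamma')>M\min\Big\{\max_{k}\mathrm{diam}(\overline\gamma_k),\max_{j}\mathrm{diam}(\overline\gamma'_j)\Big\}^a .$$ Let $\Gamma(\sigma)$ be the finest $(M,a,r)$-partition, i.e. the one each of whose elements is contained in an element of any other $(M,a,r)$-partition of $\partial\sigma$. A contour of $\sigma$ is a pair $\gamma=(\overline\gamma,\mathrm{lab}_{\overline\gamma})$ with $\overline\gamma\in\Gamma(\sigma)$, where $\mathrm{lab}_{\overline\gamma}$ assigns to the unbounded component of $\overline\gamma^{\,c}$ the sign of $\sigma$ on $\partial_{\mathrm{in}}V(\overline\gamma)$ (this sign is called $\mathrm{lab}(\gamma)$) and to each bounded component $C$ of $\overline\gamma^{\,c}$ the sign of $\sigma$ on $\partial_{\mathrm{in}}V(C)$. Write $\mathrm{sp}(\gamma)=\overline\gamma$, $|\gamma|=|\overline\gamma|$ and $V(\gamma)=V(\overline\gamma)$. A connected component $K$ of $\overline\gamma$ is external if $V(K')\subset V(K)$ for every other connected component $K'$ of $\overline\gamma$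 with $V(K')\cap V(K)\ne\emptyset$. For finite $\Lambda\subset\mathbb Z^d$ let $\mathcal E^-_\Lambda$ be the set of finite families $F$ of contours such that $F$ is the family of all contours of some configuration with finite boundary, each $\gamma\in F$ is external in $F$ (no external component of $\mathrm{sp}(\gamma)$ is contained in $V(\gamma')$ for some other $\gamma'\in F$), each $\gamma\in F$ has $\mathrm{lab}(\gamma)=-1$, and $\bigcup_{\gamma\in F}V(\gamma)\subset\Lambda$. Write $\gamma\in\mathcal E^-_\Lambda$ for $\{\gamma\}\in\mathcal E^-_\Lambda$, and for $m\ge1$ let $$\mathcal C_0(m)=\{\mathrm{sp}(\gamma):\gamma\in\mathcal E^-_\Lambda,\ 0\in V(\gamma),\ |\gamma|=m\}.$$ Proposition 3.14. Let $d\ge2$, $M>0$, and suppose that $a=\max\{\frac{d+1+\varepsilon}{\alpha-d},\,d+1+\varepsilon\}$ for some $\alpha>d$, $\varepsilon>0$, and $r=\lceil\log_2(a+1)\rceil+d+1$. Then there is a constant $c_1>0$ depending only on $d$, $M$ and $r$ such that, for every finite $\Lambda\subset\mathbb Z^d$ and every $m\ge1$, $$|\mathcal C_0(m)|\le e^{c_1m}.$$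 -/

import Mathlib

noncomputable section

namespace LongRangeIsing

/-- Sites of the lattice `ℤ^d`. -/
abbrev Site (d : ℕ) : Type := Fin d → ℤ

/-- Configurations: spins `±1` at every site. -/
abbrev Config (d : ℕ) : Type := Site d → ℤˣ

/-- The `ℓ¹` distance `|x - y|`. -/
def l1dist {d : ℕ} (x y : Site d) : ℕ := ∑ i, (x i - y i).natAbs

/-- The nearest-neighbour graph of `ℤ^d`. -/
def latticeGraph (d : ℕ) : SimpleGraph (Site d) where
  Adj x y := l1dist x y = 1
  symm := ⟨fun x y h => by
    have hxy : l1dist y x = l1dist x y :=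
      Finset.sum_congr rfl fun i _ => by omega
    exact hxy.trans h⟩
  loopless := ⟨fun x h => by simp [l1dist] at h⟩

/-- The connected component of `x` in `A` (empty if `x ∉ A`). -/
def componentOf {d : ℕ} (A : Set (Site d)) (x : Site d) : Set (Site d) :=
  {y | ∃ (hx : x ∈ A) (hy : y ∈ A), ((latticeGraph d).induce A).Reachable ⟨x, hx⟩ ⟨y, hy⟩}

/-- The connected components of a subset of the lattice. -/
def components {d : ℕ} (A : Set (Site d)) : Set (Set (Site d)) :=
  {C | ∃ x ∈ A, C = componentOf A x}

/-- `A^(0)`: the unbounded component of the complement of `A`. -/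
def exterior {d : ℕ} (A : Set (Site d)) : Set (Site d) :=
  {x | (componentOf Aᶜ x).Infinite}

/-- The volume `V(A)`: the complement of the unbounded component of the complement of `A`. -/
def volume {d : ℕ} (A : Set (Site d)) : Set (Site d) := (exterior A)ᶜ

/-- The inner boundary: the points of `A` at distance one from the complement of `A`. -/
def innerBoundary {d : ℕ} (A : Set (Site d)) : Set (Site d) :=
  {x | x ∈ A ∧ ∃ y, y ∉ A ∧ l1dist x y = 1}

/-- `x` is `s`-correct: every spin in the closed unit ball around `x` equals `s`. -/
def IsCorrect {d : ℕ} (σ : Config d) (s : ℤˣ) (x : Site d) : Prop :=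
  ∀ y, l1dist x y ≤ 1 → σ y = s

/-- The boundary of `σ`: the points that are neither plus- nor minus-correct. -/
def boundary {d : ℕ} (σ : Config d) : Set (Site d) :=
  {x | ¬ IsCorrect σ 1 x ∧ ¬ IsCorrect σ (-1) x}

/-- The distance between two finite sets (used for nonempty sets only). -/
def setDist {d : ℕ} (A B : Finset (Site d)) : ℕ :=
  sInf {n | ∃ x ∈ A, ∃ y ∈ B, n = l1dist x y}

/-- The `ℓ¹` diameter of a finite subset of the lattice, with the convention that a one-point set
has diameter `1`. (With the value `0` for points, splitting a set into its points would satisfy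
the separation condition below trivially.) -/
def diam {d : ℕ} (A : Finset (Site d)) : ℕ :=
  max 1 ((A ×ˢ A).sup fun p => l1dist p.1 p.2)

/-- The largest diameter in a finite family of sets. -/
def maxDiam {d : ℕ} (P : Finset (Finset (Site d))) : ℕ := P.sup diam

/-- `Γ` is an `(M,a,r)`-partition of the (finite) boundary of `σ`. -/
structure IsMarPartition {d : ℕ} (M a : ℝ) (r : ℕ) (σ : Config d)
    (Γ : Finset (Finset (Site d))) : Prop where
  nonempty : ∀ γ ∈ Γ, γ.Nonempty
  union_eq : (⋃ γ ∈ Γ, (γ : Set (Site d))) = boundary σ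
  disjoint : ∀ γ ∈ Γ, ∀ γ' ∈ Γ, γ ≠ γ' → Disjoint γ γ'
  /-- each part lies in a single connected component of the complement of any other part -/
  nested : ∀ γ ∈ Γ, ∀ γ' ∈ Γ, γ ≠ γ' →
    ∃ C ∈ components (γ : Set (Site d))ᶜ, (γ' : Set (Site d)) ⊆ C
  /-- each part `γ` is a union of a family `P γ` of between `1` and `2^r - 1` sets, and distinct
  parts are far apart in terms of the largest diameters in their families -/
  separated : ∃ P : Finset (Site d) → Finset (Finset (Site d)),
    (∀ γ ∈ Γ, 1 ≤ (P γ).card ∧ (P γ).card ≤ 2 ^ r - 1 ∧ (P γ).biUnion id = γ) ∧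
    ∀ γ ∈ Γ, ∀ γ' ∈ Γ, γ ≠ γ' →
      M * (min (maxDiam (P γ) : ℝ) (maxDiam (P γ') : ℝ)) ^ a < (setDist γ γ' : ℝ)

/-- `Γ` is the finest `(M,a,r)`-partition of the boundary of `σ`. -/
def IsFinestPartition {d : ℕ} (M a : ℝ) (r : ℕ) (σ : Config d)
    (Γ : Finset (Finset (Site d))) : Prop :=
  IsMarPartition M a r σ Γ ∧
    ∀ Γ', IsMarPartition M a r σ Γ' → ∀ γ ∈ Γ, ∃ γ' ∈ Γ', γ ⊆ γ'

/-- A finite support together with a sign on every connected component of its complement, that is,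
on the unbounded component and on each component of the interior. -/
structure Contour (d : ℕ) where
  support : Finset (Site d)
  label : components (support : Set (Site d))ᶜ → ℤˣ

/-- `V(γ)`. -/
def Contour.vol {d : ℕ} (γ : Contour d) : Set (Site d) := volume (γ.support : Set (Site d))

/-- The label of `γ` is the one that `σ` induces: on a component `C` of the interior it is the sign
of `σ` on the inner boundary of `V(C)`, on the unbounded component the sign of `σ` on the inner
boundary of `V(γ)`. -/
def Contour.IsLabelledBy {d : ℕ} (γ : Contour d) (σ : Config d) : Prop :=
  ∀ C : components (γ.support : Set (Site d))ᶜ,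
    (C.1.Finite → ∀ x ∈ innerBoundary (volume C.1), σ x = γ.label C) ∧
    (C.1.Infinite → ∀ x ∈ innerBoundary γ.vol, σ x = γ.label C)

/-- `F` is the family of all contours of `σ`: its supports are exactly the elements of the finest
`(M,a,r)`-partition, each with the label induced by `σ`. -/
def IsContourFamilyOf {d : ℕ} (M a : ℝ) (r : ℕ) (σ : Config d) (F : Set (Contour d)) : Prop :=
  ∃ Γ : Finset (Finset (Site d)), IsFinestPartition M a r σ Γ ∧
    Set.BijOn Contour.support F (Γ : Set (Finset (Site d))) ∧ ∀ γ ∈ F, γ.IsLabelledBy σ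

/-- `F` is compatible: it is the family of contours of a configuration with finite boundary. -/
def IsCompatible {d : ℕ} (M a : ℝ) (r : ℕ) (F : Set (Contour d)) : Prop :=
  ∃ σ : Config d, (boundary σ).Finite ∧ IsContourFamilyOf M a r σ F

/-- The external connected components of a set. -/
def externalComponents {d : ℕ} (A : Set (Site d)) : Set (Set (Site d)) :=
  {K | K ∈ components A ∧ ∀ K' ∈ components A, K' ≠ K →
    (volume K' ∩ volume K).Nonempty → volume K' ⊆ volume K}

/-- `γ` is external in the family `F`. -/
def IsExternal {d : ℕ} (F : Set (Contour d)) (γ : Contour d) : Prop :=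
  ∀ γ' ∈ F, γ' ≠ γ → ∀ K ∈ externalComponents (γ.support : Set (Site d)), ¬ K ⊆ γ'.vol

/-- `lab(γ) = s`: the label of the unbounded component of the complement of the support is `s`. -/
def Contour.HasLabel {d : ℕ} (γ : Contour d) (s : ℤˣ) : Prop :=
  ∃ C : components (γ.support : Set (Site d))ᶜ, C.1.Infinite ∧ γ.label C = s

/-- `𝓔^s_Λ`: compatible finite families of external contours with label `s` and volume in `Λ`. -/
def externalFamilies {d : ℕ} (M a : ℝ) (r : ℕ) (s : ℤˣ) (Λ : Finset (Site d)) :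
    Set (Set (Contour d)) :=
  {F | F.Finite ∧ IsCompatible M a r F ∧ (∀ γ ∈ F, IsExternal F γ ∧ γ.HasLabel s) ∧
    (⋃ γ ∈ F, γ.vol) ⊆ (Λ : Set (Site d))}

/-- `𝓒_0(m)`: the supports of contours `γ ∈ 𝓔^-_Λ` with `0 ∈ V(γ)` and `|γ| = m`. -/
def contourSupports {d : ℕ} (M a : ℝ) (r : ℕ) (Λ : Finset (Site d)) (m : ℕ) :
    Set (Finset (Site d)) :=
  {A | ∃ γ : Contour d, γ.support = A ∧ {γ} ∈ externalFamilies M a r (-1) Λ ∧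
    (0 : Site d) ∈ γ.vol ∧ γ.support.card = m}

/-- The exponent `a = max {(d+1+ε)/(α-d), d+1+ε}`. -/
def contourExponent (d : ℕ) (α ε : ℝ) : ℝ :=
  max (((d : ℝ) + 1 + ε) / (α - d)) ((d : ℝ) + 1 + ε)

/-- The parameter `r = ⌈log₂ (a+1)⌉ + d + 1`. -/
def contourR (d : ℕ) (a : ℝ) : ℕ := ⌈Real.logb 2 (a + 1)⌉₊ + d + 1

end LongRangeIsing

end

namespace LongRangeIsing

variable {d : ℕ}

/-! ### The `ℓ¹` distance and connectedness along boxes -/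

/-! A contour that forms a compatible family alone has an indecomposable support: the finest
partition has one part, so no `(M,a,r)`-partition splits the support γ. This makes γ cheap to
describe at a tower of scales.

Let S be an R-net of γ, t about M(2R)^a, and let c be a point of γ. The t-chain component U of c is
either long, and then meets many disjoint shells around c, each yielding its own net point, or
short. If a short U has fewer than 2^r net points nearby, they cover it by at most 2^r - 1 sets of
diameter at most 2R, and splitting γ into U and the rest is admissible
(`IsIndecomposable.eq_of_cover`). Hence, unless γ lies in one ball of radius ρ of order 2^r t, every
such ball centred in γ holds at least 2^r net points (`IsIndecomposable.card_net_ball`). A maximal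
2ρ-separated subset of γ is therefore a net at the next scale with at most |S|/2^r points
(`IsIndecomposable.exists_coarser_net`).

Iterating from S = γ, the scales obey R_{k+1} = R_k^Q with Q = 2^(r-3) ≥ a + 1, so log R_k grows
like Q^k while the nets have at most m/2^(rk) points. Recovering one net from the next costs entropy
of order m (Q/2^r)^k, up to constants. Since 8Q ≤ 2^r, this is a convergent geometric series, of
total order m (`exists_finset_isMultiscale`). The tower stops when γ fits in one ball; there 0 ∈
V(γ) pins γ near the origin (`subset_box_of_zero_mem_volume`). -/

lemma l1dist_self (x : Site d) : l1dist x x = 0 := by simp [l1dist]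

lemma l1dist_comm (x y : Site d) : l1dist x y = l1dist y x :=
  Finset.sum_congr rfl fun i _ => by omega

lemma l1dist_triangle (x y z : Site d) : l1dist x z ≤ l1dist x y + l1dist y z := by
  unfold l1dist
  rw [← Finset.sum_add_distrib]
  exact Finset.sum_le_sum fun i _ => by omega

lemma natAbs_le_l1dist (x y : Site d) (i : Fin d) : (x i - y i).natAbs ≤ l1dist x y :=
  Finset.single_le_sum (f := fun i => (x i - y i).natAbs) (fun _ _ => Nat.zero_le _)
    (Finset.mem_univ i)

lemma l1dist_update_self (x : Site d) (i : Fin d) (v : ℤ) :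
    l1dist x (Function.update x i v) = (x i - v).natAbs := by
  unfold l1dist
  rw [Finset.sum_eq_single i]
  · simp
  · intro j _ hj
    simp [Function.update_of_ne hj]
  · simp

/-- `z` lies in the coordinate box spanned by `x` and `y`. -/
def Between (x y z : Site d) : Prop := ∀ i, z i ∈ Set.uIcc (x i) (y i)

lemma Between.l1dist_add {x y z : Site d} (h : Between x y z) :
    l1dist x z + l1dist z y = l1dist x y := by
  unfold l1dist
  rw [← Finset.sum_add_distrib]
  refine Finset.sum_congr rfl fun i _ => ?_
  have := h i
  rw [Set.mem_uIcc] at this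
  omega

lemma mem_componentOf_refl {A : Set (Site d)} {x : Site d} (hx : x ∈ A) :
    x ∈ componentOf A x := ⟨hx, hx, SimpleGraph.Reachable.refl _⟩

lemma componentOf_trans {A : Set (Site d)} {x y z : Site d} (h : y ∈ componentOf A x)
    (h' : z ∈ componentOf A y) : z ∈ componentOf A x := by
  obtain ⟨hx, _, h⟩ := h
  obtain ⟨_, hz, h'⟩ := h'
  exact ⟨hx, hz, h.trans h'⟩

lemma componentOf_symm {A : Set (Site d)} {x y : Site d} (h : y ∈ componentOf A x) :
    x ∈ componentOf A y := by
  obtain ⟨hx, hy, h⟩ := h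
  exact ⟨hy, hx, h.symm⟩

lemma mem_componentOf_of_adj {A : Set (Site d)} {x y : Site d} (hx : x ∈ A) (hy : y ∈ A)
    (h : l1dist x y = 1) : y ∈ componentOf A x := by
  refine ⟨hx, hy, SimpleGraph.Adj.reachable ?_⟩
  exact h

/-- Two points are connected in `A` as soon as `A` contains the box they span. -/
lemma mem_componentOf_of_box {A : Set (Site d)} (x y : Site d)
    (h : ∀ z, Between x y z → z ∈ A) : y ∈ componentOf A x := by
  induction hn : l1dist x y using Nat.strong_induction_on generalizing x with
  | _ n ih =>
    have hxA : x ∈ A := h x fun i => Set.left_mem_uIcc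
    by_cases hxy : x = y
    · subst hxy
      exact mem_componentOf_refl hxA
    obtain ⟨i, hi⟩ := Function.ne_iff.mp hxy
    obtain ⟨v, hv1, hv2⟩ : ∃ v : ℤ, (x i - v).natAbs = 1 ∧ v ∈ Set.uIcc (x i) (y i) := by
      rcases lt_or_gt_of_ne hi with hlt | hlt
      · exact ⟨x i + 1, by omega, by rw [Set.mem_uIcc]; omega⟩
      · exact ⟨x i - 1, by omega, by rw [Set.mem_uIcc]; omega⟩
    set w := Function.update x i v with hw
    have hxw : Between x y w := by
      intro j
      by_cases hj : j = i
      · subst hj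
        simpa [hw] using hv2
      · simp [hw, Function.update_of_ne hj]
    have h1 : l1dist x w = 1 := by rw [hw, l1dist_update_self, hv1]
    have hadd := hxw.l1dist_add
    refine componentOf_trans (mem_componentOf_of_adj hxA (h w hxw) h1)
      (ih (l1dist w y) (by omega) w (fun z hz => h z fun j => ?_) rfl)
    exact Set.uIcc_subset_uIcc (hxw j) Set.right_mem_uIcc (hz j)

/-- A point of the complement of `U` that can reach a hyperplane missing `U` without meeting `U`
is connected to a point far away in direction `i`. -/
lemma mem_componentOf_far {U : Finset (Site d)} {i j : Fin d} (hij : i ≠ j) (x : Site d) (L v : ℤ)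
    (hL : ∀ u ∈ U, u i < L)
    (hseg : ∀ z, Between x (Function.update x j v) z → z ∉ U)
    (hv : ∀ u ∈ U, u j ≠ v) :
    x ∈ componentOf ((U : Set (Site d))ᶜ) (fun _ => L) := by
  set y := Function.update x j v with hy
  set z := Function.update y i L with hz
  have h1 : y ∈ componentOf ((U : Set (Site d))ᶜ) x :=
    mem_componentOf_of_box x y fun w hw => by simpa using hseg w hw
  have h2 : z ∈ componentOf ((U : Set (Site d))ᶜ) y := by
    refine mem_componentOf_of_box y z fun w hw hwU => ?_
    have := hw j
    rw [hz, Function.update_of_ne hij.symm, Set.uIcc_self, hy, Function.update_self] at this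
    exact hv w hwU this
  have h3 : (fun _ => L) ∈ componentOf ((U : Set (Site d))ᶜ) z := by
    refine mem_componentOf_of_box z _ fun w hw hwU => ?_
    have := hw i
    rw [hz, Function.update_self, Set.uIcc_self] at this
    exact (hL w hwU).ne this
  exact componentOf_symm (componentOf_trans h1 (componentOf_trans h2 h3))

/-! ### Diameters, missed hyperplanes and distances between sets -/

lemma l1dist_le_diam {A : Finset (Site d)} {x y : Site d} (hx : x ∈ A) (hy : y ∈ A) :
    l1dist x y ≤ diam A :=
  (Finset.le_sup (f := fun p : Site d × Site d => l1dist p.1 p.2) (Finset.mk_mem_product hx hy)).trans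
    (le_max_right _ _)

lemma diam_le {A : Finset (Site d)} {D : ℕ} (hD : 1 ≤ D)
    (h : ∀ x ∈ A, ∀ y ∈ A, l1dist x y ≤ D) : diam A ≤ D := by
  refine max_le hD (Finset.sup_le fun p hp => ?_)
  rw [Finset.mem_product] at hp
  exact h _ hp.1 _ hp.2

lemma card_image_coord_le {A : Finset (Site d)} (j : Fin d) :
    (A.image fun x => x j).card ≤ diam A + 1 := by
  rcases A.eq_empty_or_nonempty with rfl | hA
  · simp
  obtain ⟨x, hx, hmin⟩ := A.exists_min_image (fun x => x j) hA
  have : (A.image fun x => x j) ⊆ Finset.Icc (x j) (x j + diam A) := by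
    intro v hv
    obtain ⟨y, hy, rfl⟩ := Finset.mem_image.mp hv
    have h1 := hmin y hy
    have h2 := (natAbs_le_l1dist y x j).trans (l1dist_le_diam hy hx)
    rw [Finset.mem_Icc]
    omega
  refine (Finset.card_le_card this).trans ?_
  rw [Int.card_Icc]
  omega

/-- A set covered by few sets of small diameter misses a hyperplane close to any given one. -/
lemma exists_coord_notMem {P : Finset (Finset (Site d))} {D t : ℕ} (hP : ∀ p ∈ P, diam p ≤ D)
    (ht : P.card * (D + 1) ≤ t) (j : Fin d) (v : ℤ) :
    ∃ n : ℕ, n ≤ t ∧ ∀ u ∈ P.biUnion id, u j ≠ v + n := by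
  by_contra! hcon
  -- Pigeonhole: the t + 1 values would all be `j`-th coordinates of points in the cover, but each
  -- member supplies at most D + 1 of them.
  have hsub : (Finset.range (t + 1)).image (fun n : ℕ => v + (n : ℤ)) ⊆
      P.biUnion fun p => p.image fun x => x j := by
    intro w hw
    obtain ⟨n, hn, rfl⟩ := Finset.mem_image.mp hw
    obtain ⟨u, hu, hun⟩ := hcon n (by simpa [Nat.lt_succ_iff] using hn)
    obtain ⟨p, hp, hup⟩ := Finset.mem_biUnion.mp hu
    exact Finset.mem_biUnion.mpr ⟨p, hp, Finset.mem_image.mpr ⟨u, hup, hun⟩⟩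
  have h1 := Finset.card_le_card hsub
  rw [Finset.card_image_of_injective _ (fun a b h => by simpa using h), Finset.card_range] at h1
  have h2 := Finset.card_biUnion_le_card_mul P (fun p => p.image fun x => x j) (D + 1)
    fun p hp => (card_image_coord_le j).trans (Nat.succ_le_succ (hP p hp))
  omega

lemma lt_setDist {A B : Finset (Site d)} (hA : A.Nonempty) (hB : B.Nonempty) {t : ℕ}
    (h : ∀ x ∈ A, ∀ y ∈ B, t < l1dist x y) : t < setDist A B := by
  obtain ⟨x, hx⟩ := hA
  obtain ⟨y, hy⟩ := hB
  have hne : {n | ∃ x ∈ A, ∃ y ∈ B, n = l1dist x y}.Nonempty := ⟨_, x, hx, y, hy, rfl⟩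
  obtain ⟨x', hx', y', hy', he⟩ := Nat.sInf_mem hne
  have := h x' hx' y' hy'
  unfold setDist
  omega

/-! ### Indecomposable boundaries -/

/-- The relation of being joined by a chain of points of `A` with steps of length at most `t`. -/
def Chained (A : Finset (Site d)) (t : ℕ) : Site d → Site d → Prop :=
  Relation.ReflTransGen fun x y => x ∈ A ∧ y ∈ A ∧ l1dist x y ≤ t

/-- `γ` is the boundary of a configuration for which every `(M,a,r)`-partition is trivial. -/
structure IsIndecomposable (M a : ℝ) (r : ℕ) (γ : Finset (Site d)) : Prop where
  exists_config : ∃ σ : Config d, boundary σ = (γ : Set (Site d)) ∧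
    ∀ Γ, IsMarPartition M a r σ Γ → ∃ γ' ∈ Γ, γ ⊆ γ'

/-- A proper part of an indecomposable boundary that is far from the rest cannot be covered by
few sets of small diameter. -/
lemma IsIndecomposable.eq_of_cover {M a : ℝ} {r : ℕ} {γ : Finset (Site d)}
    (hγ : IsIndecomposable M a r γ) (hd : 2 ≤ d) (hM : 0 ≤ M) (ha : 0 ≤ a) (hr : 1 ≤ r)
    {U : Finset (Site d)} (hUγ : U ⊆ γ) {c : Site d} (hc : c ∈ U) {t D : ℕ}
    (hchain : ∀ u ∈ U, Chained U t c u) (hfar : ∀ u ∈ U, ∀ w ∈ γ, w ∉ U → t < l1dist u w)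
    {P : Finset (Finset (Site d))} (hP : P.card ≤ 2 ^ r - 1) (hPU : P.biUnion id = U)
    (hPD : ∀ p ∈ P, diam p ≤ D) (hDt : M * (D : ℝ) ^ a < t + 1) (ht : 2 ^ r * (D + 1) ≤ t) :
    U = γ := by
  classical
  by_contra hne
  set W := γ \ U with hW
  have hWne : W.Nonempty := by
    rw [hW, Finset.sdiff_nonempty]
    exact fun h => hne (hUγ.antisymm h)
  have hUne : U.Nonempty := ⟨c, hc⟩
  have hUW : U ≠ W := fun h => by
    rw [h, hW] at hc
    exact (Finset.mem_sdiff.mp hc).2 (by rw [← hW, ← h] at hc; exact hc)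
  have hfar' : ∀ u ∈ U, ∀ w ∈ W, t < l1dist u w := fun u hu w hw =>
    hfar u hu w (Finset.mem_sdiff.mp hw).1 (Finset.mem_sdiff.mp hw).2
  obtain ⟨σ, hσ, hfin⟩ := hγ.exists_config
  have hPne : 1 ≤ P.card := by
    rw [Nat.one_le_iff_ne_zero, Finset.card_ne_zero]
    rw [← hPU] at hc
    obtain ⟨p, hp, -⟩ := Finset.mem_biUnion.mp hc
    exact ⟨p, hp⟩
  have hpow : 1 ≤ 2 ^ r - 1 := by
    have : 2 ^ 1 ≤ 2 ^ r := Nat.pow_le_pow_right (by norm_num) hr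
    omega
  -- From w ∈ W, a shift of length at most t in direction 1 cannot meet U and reaches a hyperplane
  -- missing U. Inside it one escapes in direction 0 to a point independent of w; this needs two
  -- directions.
  have hnestU : ∃ C ∈ components (U : Set (Site d))ᶜ, (W : Set (Site d)) ⊆ C := by
    obtain ⟨L, hL⟩ : ∃ L : ℤ, ∀ u ∈ U, u ⟨0, by omega⟩ < L := by
      obtain ⟨b, hb⟩ := (U.image fun u => u ⟨0, by omega⟩).exists_le
      exact ⟨b + 1, fun u hu => Int.lt_add_one_of_le (hb _ (Finset.mem_image_of_mem _ hu))⟩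
    have key : ∀ w ∈ W, w ∈ componentOf ((U : Set (Site d))ᶜ) (fun _ => L) := by
      intro w hw
      obtain ⟨n, hn, hun⟩ := exists_coord_notMem hPD (t := t)
        (le_trans (Nat.mul_le_mul_right _ (by omega)) ht) ⟨1, by omega⟩ (w ⟨1, by omega⟩)
      rw [hPU] at hun
      refine mem_componentOf_far (by simp) w L _ hL (fun z hz hzU => ?_) hun
      have h1 := hz.l1dist_add
      rw [l1dist_update_self] at h1
      have h2 := hfar' z hzU w hw
      rw [l1dist_comm] at h2
      omega
    obtain ⟨w, hw⟩ := hWne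
    exact ⟨_, ⟨_, (key w hw).1, rfl⟩, fun w hw => key w hw⟩
  -- The box spanned by two consecutive chain points stays within t of U, hence misses W.
  have hnestW : ∃ C ∈ components (W : Set (Site d))ᶜ, (U : Set (Site d)) ⊆ C := by
    have hcW : c ∈ (W : Set (Site d))ᶜ := fun h => (Finset.mem_sdiff.mp h).2 hc
    refine ⟨_, ⟨c, hcW, rfl⟩, fun u hu => ?_⟩
    induction hchain u hu with
    | refl => exact mem_componentOf_refl hcW
    | tail _ hstep ih =>
      refine componentOf_trans (ih hstep.1) (mem_componentOf_of_box _ _ fun z hz hzW => ?_)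
      have h1 := hz.l1dist_add
      have h2 := hfar' _ hstep.1 z hzW
      have h3 := hstep.2.2
      omega
  have hbound : ∀ m : ℝ, 0 ≤ m → m ≤ D → M * m ^ a < t + 1 := fun m hm hmD =>
    (mul_le_mul_of_nonneg_left (Real.rpow_le_rpow hm hmD ha) hM).trans_lt hDt
  have hPmax : (maxDiam P : ℝ) ≤ D := Nat.cast_le.mpr (Finset.sup_le hPD)
  have hdist : (t : ℝ) + 1 ≤ setDist U W := by
    exact_mod_cast lt_setDist hUne hWne hfar'
  have hdist' : (t : ℝ) + 1 ≤ setDist W U := by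
    exact_mod_cast lt_setDist hWne hUne fun w hw u hu => by
      rw [l1dist_comm]
      exact hfar' u hu w hw
  have hpart : IsMarPartition M a r σ {U, W} := by
    -- W may be taken as a single set: the separation condition involves the minimum of the two
    -- diameters, already controlled by the cover of U.
    refine ⟨?_, ?_, ?_, ?_, fun γ' => if γ' = U then P else {γ'}, ?_, ?_⟩
    · simp [hUne, hWne]
    · rw [hσ]
      simp [hW, Set.union_sdiff_cancel (Finset.coe_subset.mpr hUγ)]
    · have hdisj : Disjoint U W := Finset.disjoint_sdiff
      intro A hA B hB hAB
      simp only [Finset.mem_insert, Finset.mem_singleton] at hA hB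
      rcases hA with rfl | rfl <;> rcases hB with rfl | rfl
      exacts [absurd rfl hAB, hdisj, hdisj.symm, absurd rfl hAB]
    · intro A hA B hB hAB
      simp only [Finset.mem_insert, Finset.mem_singleton] at hA hB
      rcases hA with rfl | rfl <;> rcases hB with rfl | rfl
      exacts [absurd rfl hAB, hnestU, hnestW, absurd rfl hAB]
    · intro A hA
      by_cases hAU : A = U
      · simp only [hAU, if_true]
        exact ⟨hPne, hP, hPU⟩
      · simp [hAU, hpow]
    · intro A hA B hB hAB
      simp only [Finset.mem_insert, Finset.mem_singleton] at hA hB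
      have hWU : ¬ W = U := fun h => hUW h.symm
      rcases hA with hA | hA <;> rcases hB with hB | hB
      · exact absurd (hA.trans hB.symm) hAB
      · simp only [hA, hB, if_true, if_neg hWU]
        exact (hbound _ (by positivity) ((min_le_left _ _).trans hPmax)).trans_le hdist
      · simp only [hA, hB, if_true, if_neg hWU]
        exact (hbound _ (by positivity) ((min_le_right _ _).trans hPmax)).trans_le hdist'
      · exact absurd (hA.trans hB.symm) hAB
  obtain ⟨γ', hγ', hsub⟩ := hfin _ hpart
  simp only [Finset.mem_insert, Finset.mem_singleton] at hγ'
  rcases hγ' with rfl | rfl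
  · exact hne (hUγ.antisymm hsub)
  · exact (Finset.mem_sdiff.mp (hsub (hUγ hc))).2 hc

/-! ### Nets in an indecomposable boundary -/

/-- Discrete intermediate value principle: one step changes the distance to c by at most t. -/
lemma Chained.exists_intermediate {A : Finset (Site d)} {t : ℕ} {c u : Site d}
    (h : Chained A t c u) (n : ℕ) (hn : n ≤ l1dist c u) :
    ∃ v, Chained A t c v ∧ n ≤ l1dist c v ∧ l1dist c v ≤ n + t := by
  induction h with
  | refl =>
    rw [l1dist_self] at hn
    exact ⟨c, Relation.ReflTransGen.refl, by rw [l1dist_self]; exact hn, by rw [l1dist_self]; omega⟩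
  | @tail v w hcv hvw ih =>
    by_cases hnv : n ≤ l1dist c v
    · exact ih hnv
    · have := l1dist_triangle c v w
      have := hvw.2.2
      exact ⟨w, hcv.tail hvw, hn, by omega⟩

lemma Chained.mem {A : Finset (Site d)} {t : ℕ} {c u : Site d} (h : Chained A t c u) (hc : c ∈ A) :
    u ∈ A := by
  cases h with
  | refl => exact hc
  | tail _ h => exact h.2.1

/-- If an indecomposable boundary is not contained in a ball around one of its points, then that
ball contains at least `2 ^ r` points of any net of smaller scale. -/
lemma IsIndecomposable.card_net_ball {M a : ℝ} {r : ℕ} {γ : Finset (Site d)}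
    (hγ : IsIndecomposable M a r γ) (hd : 2 ≤ d) (hM : 0 ≤ M) (ha : 0 ≤ a) (hr : 1 ≤ r)
    {S : Finset (Site d)} {R t : ℕ} (hR : 1 ≤ R) (hS : ∀ x ∈ γ, ∃ s ∈ S, l1dist x s ≤ R)
    (hDt : M * ((2 * R : ℕ) : ℝ) ^ a < t + 1) (ht : 2 ^ r * (2 * R + 1) ≤ t)
    {c : Site d} (hc : c ∈ γ) (hout : ∃ x ∈ γ, 2 ^ r * (t + 2 * R + 1) < l1dist c x) :
    2 ^ r ≤ (S.filter fun s => l1dist c s ≤ 2 ^ r * (t + 2 * R + 1)).card := by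
  classical
  set H := t + 2 * R + 1 with hH
  set U := γ.filter fun u => Chained γ t c u with hU
  have hpow : 1 ≤ 2 ^ r := Nat.one_le_two_pow
  obtain ⟨q, hq⟩ : ∃ q, 2 ^ r = q + 1 := ⟨2 ^ r - 1, by omega⟩
  -- With q = 2^r - 1, a long component crosses the distances jH for 0 ≤ j ≤ q. Net points chosen at
  -- these crossings lie at distances in [jH - R, jH + t + R] from c, and H = t + 2R + 1 is the
  -- least spacing making these intervals disjoint.
  by_cases hlong : ∃ u ∈ U, q * H ≤ l1dist c u
  · obtain ⟨u, hu, hqu⟩ := hlong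
    have hex : ∀ j : ℕ, ∃ s, j < 2 ^ r → s ∈ S ∧ j * H ≤ l1dist c s + R ∧
        l1dist c s ≤ j * H + t + R := by
      intro j
      by_cases hj : j < 2 ^ r
      · have hjq : j * H ≤ q * H := Nat.mul_le_mul_right _ (by omega)
        obtain ⟨v, hv, h1, h2⟩ := (Finset.mem_filter.mp hu).2.exists_intermediate (j * H)
          (hjq.trans hqu)
        obtain ⟨s, hs, hvs⟩ := hS v (hv.mem hc)
        have h3 := l1dist_triangle c v s
        have h4 := l1dist_triangle c s v
        rw [l1dist_comm s v] at h4
        exact ⟨s, fun _ => ⟨hs, by omega, by omega⟩⟩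
      -- Dummy value outside the range of j.
      · exact ⟨c, fun h => absurd h hj⟩
    choose s hs using hex
    have hinj : Set.InjOn s (Finset.range (2 ^ r) : Set ℕ) := by
      have hlt : ∀ i j : ℕ, i < 2 ^ r → j < 2 ^ r → i < j → s i ≠ s j := by
        intro i j hi hj hij heq
        have h1 := (hs i hi).2.2
        have h2 := (hs j hj).2.1
        rw [heq] at h1
        have h3 : (i + 1) * H ≤ j * H := Nat.mul_le_mul_right _ hij
        rw [Nat.add_mul] at h3
        omega
      intro i hi j hj heq
      simp only [Finset.coe_range, Set.mem_Iio] at hi hj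
      rcases lt_trichotomy i j with h | h | h
      exacts [absurd heq (hlt i j hi hj h), h, absurd heq.symm (hlt j i hj hi h)]
    calc 2 ^ r = ((Finset.range (2 ^ r)).image s).card := by
          rw [Finset.card_image_of_injOn hinj, Finset.card_range]
      _ ≤ _ := by
          refine Finset.card_le_card fun x hx => ?_
          obtain ⟨j, hj, rfl⟩ := Finset.mem_image.mp hx
          rw [Finset.mem_range] at hj
          have h1 := hs j hj
          have h2 : (j + 1) * H ≤ 2 ^ r * H := Nat.mul_le_mul_right _ hj
          rw [Nat.add_mul] at h2
          exact Finset.mem_filter.mpr ⟨h1.1, by omega⟩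
  -- Now U lies within qH of c, so every net point within R of U lies in the ball of radius 2^r H.
  -- Fewer than 2^r of them would cover U, forcing U = γ, although γ leaves that ball.
  · push Not at hlong
    by_contra! hcard
    set N := S.filter fun s => l1dist c s ≤ 2 ^ r * H with hN
    have hUγ : U ⊆ γ := Finset.filter_subset _ _
    have hcU : c ∈ U := Finset.mem_filter.mpr ⟨hc, Relation.ReflTransGen.refl⟩
    have hUeq : U = γ := by
      refine hγ.eq_of_cover hd hM ha hr hUγ hcU (t := t) (D := 2 * R)
        (P := N.image fun s => U.filter fun u => l1dist u s ≤ R) ?_ ?_ ?_ ?_ ?_ hDt ht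
      · intro u hu
        have hch := (Finset.mem_filter.mp hu).2
        clear hu
        induction hch with
        | refl => exact Relation.ReflTransGen.refl
        | @tail v w hcv hvw ih =>
          exact ih.tail ⟨Finset.mem_filter.mpr ⟨hvw.1, hcv⟩,
            Finset.mem_filter.mpr ⟨hvw.2.1, hcv.tail hvw⟩, hvw.2.2⟩
      · intro u hu w hw hwU
        by_contra! hle
        rw [hU, Finset.mem_filter] at hu
        exact hwU (Finset.mem_filter.mpr ⟨hw, hu.2.tail ⟨hu.1, hw, hle⟩⟩)
      · exact Finset.card_image_le.trans (by omega)
      · ext u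
        simp only [Finset.mem_biUnion, Finset.mem_image, id_eq, exists_exists_and_eq_and,
          Finset.mem_filter (s := U)]
        constructor
        · rintro ⟨s, -, hu, -⟩
          exact hu
        · intro hu
          obtain ⟨s, hs, hus⟩ := hS u (hUγ hu)
          have h1 := hlong u hu
          have h2 := l1dist_triangle c u s
          refine ⟨s, Finset.mem_filter.mpr ⟨hs, ?_⟩, hu, hus⟩
          rw [hq, Nat.add_mul]
          omega
      · intro p hp
        obtain ⟨s, -, rfl⟩ := Finset.mem_image.mp hp
        refine diam_le (by omega) fun x hx y hy => ?_
        have h1 := (Finset.mem_filter.mp hx).2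
        have h2 := (Finset.mem_filter.mp hy).2
        have h3 := l1dist_triangle x s y
        rw [l1dist_comm s y] at h3
        omega
    obtain ⟨x, hx, hxout⟩ := hout
    rw [← hUeq] at hx
    have h1 := hlong x hx
    rw [hq, Nat.add_mul] at hxout
    omega

/-- Every finite set contains a maximal `ρ`-separated subset, which is then a `ρ`-net. -/
lemma exists_separated_net (γ : Finset (Site d)) (ρ : ℕ) :
    ∃ S ⊆ γ, (∀ x ∈ S, ∀ y ∈ S, x ≠ y → ρ < l1dist x y) ∧ ∀ x ∈ γ, ∃ s ∈ S, l1dist x s ≤ ρ := by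
  classical
  set F := γ.powerset.filter fun S => ∀ x ∈ S, ∀ y ∈ S, x ≠ y → ρ < l1dist x y with hF
  have hFne : F.Nonempty := ⟨∅, by simp [hF]⟩
  obtain ⟨S, hS, hmax⟩ := F.exists_max_image Finset.card hFne
  obtain ⟨hSγ, hsep⟩ := Finset.mem_filter.mp hS
  rw [Finset.mem_powerset] at hSγ
  refine ⟨S, hSγ, hsep, fun x hx => ?_⟩
  by_contra! hcon
  have hxS : x ∉ S := fun h => by
    have := hcon x h
    rw [l1dist_self] at this
    omega
  have hins : insert x S ∈ F := by
    refine Finset.mem_filter.mpr ⟨Finset.mem_powerset.mpr (Finset.insert_subset hx hSγ), ?_⟩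
    intro y hy z hz hyz
    rcases Finset.mem_insert.mp hy with hyx | hyS <;> rcases Finset.mem_insert.mp hz with hzx | hzS
    · exact absurd (hyx.trans hzx.symm) hyz
    · exact hyx ▸ hcon z hzS
    · rw [l1dist_comm]
      exact hzx ▸ hcon y hyS
    · exact hsep y hyS z hzS hyz
  have := hmax _ hins
  rw [Finset.card_insert_of_notMem hxS] at this
  omega

/-- The net at the next scale has at most a `2 ^ r`-th of the points. -/
lemma IsIndecomposable.exists_coarser_net {M a : ℝ} {r : ℕ} {γ : Finset (Site d)}
    (hγ : IsIndecomposable M a r γ) (hd : 2 ≤ d) (hM : 0 ≤ M) (ha : 0 ≤ a) (hr : 1 ≤ r)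
    {S : Finset (Site d)} {R t : ℕ} (hR : 1 ≤ R) (hS : ∀ x ∈ γ, ∃ s ∈ S, l1dist x s ≤ R)
    (hDt : M * ((2 * R : ℕ) : ℝ) ^ a < t + 1) (ht : 2 ^ r * (2 * R + 1) ≤ t)
    (hout : ∀ c ∈ γ, ∃ x ∈ γ, 2 ^ r * (t + 2 * R + 1) < l1dist c x) :
    ∃ S' ⊆ γ, 2 ^ r * S'.card ≤ S.card ∧
      ∀ x ∈ γ, ∃ s ∈ S', l1dist x s ≤ 2 * (2 ^ r * (t + 2 * R + 1)) := by
  classical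
  set ρ := 2 ^ r * (t + 2 * R + 1) with hρ
  obtain ⟨S', hS'γ, hsep, hnet⟩ := exists_separated_net γ (2 * ρ)
  refine ⟨S', hS'γ, ?_, hnet⟩
  have hdisj : (S' : Set (Site d)).PairwiseDisjoint
      fun c => S.filter fun s => l1dist c s ≤ ρ := by
    intro c hc c' hc' hne
    refine Finset.disjoint_left.mpr fun s hs hs' => ?_
    have h1 := hsep c hc c' hc' hne
    have h2 := l1dist_triangle c s c'
    rw [l1dist_comm s c'] at h2
    have h3 := (Finset.mem_filter.mp hs).2
    have h4 := (Finset.mem_filter.mp hs').2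
    omega
  calc 2 ^ r * S'.card = ∑ _c ∈ S', 2 ^ r := by rw [Finset.sum_const, smul_eq_mul, mul_comm]
    _ ≤ ∑ c ∈ S', (S.filter fun s => l1dist c s ≤ ρ).card :=
        Finset.sum_le_sum fun c hc =>
          hγ.card_net_ball hd hM ha hr hR hS hDt ht (hS'γ hc) (hout c (hS'γ hc))
    _ = (S'.biUnion fun c => S.filter fun s => l1dist c s ≤ ρ).card :=
        (Finset.card_biUnion hdisj).symm
    _ ≤ S.card := Finset.card_le_card
        (Finset.biUnion_subset.mpr fun c _ => Finset.filter_subset _ _)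

/-! ### Multiscale families and their number -/

/-- The cube of side `2 * R + 1` centred at `c`. -/
noncomputable def box (c : Site d) (R : ℕ) : Finset (Site d) :=
  Fintype.piFinset fun i => Finset.Icc (c i - R) (c i + R)

lemma mem_box {c x : Site d} {R : ℕ} : x ∈ box c R ↔ ∀ i, (x i - c i).natAbs ≤ R := by
  simp only [box, Fintype.mem_piFinset, Finset.mem_Icc]
  exact forall_congr' fun i => by omega

lemma mem_box_of_l1dist_le {c x : Site d} {R : ℕ} (h : l1dist x c ≤ R) : x ∈ box c R :=
  mem_box.mpr fun i => (natAbs_le_l1dist x c i).trans h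

lemma card_box (c : Site d) (R : ℕ) : (box c R).card = (2 * R + 1) ^ d := by
  have h : ∀ i, (Finset.Icc (c i - (R : ℤ)) (c i + R)).card = 2 * R + 1 := fun i => by
    rw [Int.card_Icc]
    omega
  simp [box, Fintype.card_piFinset, h]

/-- Sets that can be recovered through a sequence of nets at the scales `R (k + 1), R (k + 2), …`,
each having at most a `2 ^ r`-th of the points of the preceding one, and the last of which lies
close to the origin. -/
inductive IsMultiscale (r : ℕ) (R : ℕ → ℕ) : ℕ → Finset (Site d) → Prop
  | near {k : ℕ} {S : Finset (Site d)} (h : S ⊆ box 0 (4 * R (k + 1))) : IsMultiscale r R k S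
  | coarsen {k : ℕ} {S S' : Finset (Site d)} (hcard : 2 ^ r * S'.card ≤ S.card)
      (hS : S ⊆ S'.biUnion fun s => box s (R (k + 1))) (h : IsMultiscale r R (k + 1) S') :
      IsMultiscale r R k S

/-- The factorial cancels the factor n^n up to e^n. Choosing n points among nV thus costs only O(1 +
log V) per point, with no log n. -/
lemma choose_le_exp {N n : ℕ} {V x : ℝ} (hN : (N : ℝ) ≤ n * V) (hV : V ≤ Real.exp x) :
    (N.choose n : ℝ) ≤ Real.exp (n * (1 + x)) := by
  have hn : (0 : ℝ) ≤ n := n.cast_nonneg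
  have h1 : (N : ℝ) ≤ n * Real.exp x := hN.trans (mul_le_mul_of_nonneg_left hV hn)
  calc (N.choose n : ℝ) ≤ (N : ℝ) ^ n / (n.factorial : ℝ) := Nat.choose_le_pow_div n N
    _ ≤ (n * Real.exp x) ^ n / (n.factorial : ℝ) := by gcongr
    _ = (n : ℝ) ^ n / (n.factorial : ℝ) * Real.exp x ^ n := by ring
    _ ≤ Real.exp n * Real.exp x ^ n := by
        gcongr
        exact Real.pow_div_factorial_le_exp _ hn n
    _ = Real.exp (n * (1 + x)) := by
        rw [← Real.exp_nat_mul, ← Real.exp_add]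
        congr 1
        ring

/-- The number of multiscale sets with `n` points is exponential in `n`. -/
lemma exists_finset_isMultiscale {r Q : ℕ} (hQ : 1 ≤ Q) (hQr : 8 * Q ≤ 2 ^ r) {R : ℕ → ℕ} {b : ℝ}
    (hb : 0 ≤ b) (hR1 : ∀ k, 1 ≤ R k) (hR : ∀ k, ((9 * R k : ℕ) : ℝ) ^ d ≤ Real.exp (b * Q ^ k))
    (n k : ℕ) :
    ∃ 𝓐 : Finset (Finset (Site d)), (𝓐.card : ℝ) ≤ Real.exp (4 * (2 + b * Q) * n * Q ^ k) ∧
      ∀ S : Finset (Site d), S.card = n → IsMultiscale r R k S → S ∈ 𝓐 := by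
  induction n using Nat.strong_induction_on generalizing k with
  | _ n ih =>
    rcases Nat.eq_zero_or_pos n with rfl | hn
    · exact ⟨{∅}, by simp, fun S hS _ => by simpa using hS⟩
    have hn1 : (1 : ℝ) ≤ n := by exact_mod_cast hn
    -- The families supplied by the induction hypothesis, with an empty default for sizes not below
    -- n.
    set A : ℕ → Finset (Finset (Site d)) := fun n' =>
      if h : n' < n then (ih n' h (k + 1)).choose else ∅ with hA
    have hAcard : ∀ n' < n, ((A n').card : ℝ) ≤ Real.exp (4 * (2 + b * Q) * n' * Q ^ (k + 1)) := by
      intro n' h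
      rw [hA]
      simp only [h, dif_pos]
      exact (ih n' h (k + 1)).choose_spec.1
    have hAmem : ∀ n' < n, ∀ S : Finset (Site d), S.card = n' → IsMultiscale r R (k + 1) S →
        S ∈ A n' := by
      intro n' h
      rw [hA]
      simp only [h, dif_pos]
      exact (ih n' h (k + 1)).choose_spec.2
    set I := (Finset.range n).filter fun n' => 2 ^ r * n' ≤ n with hI
    set E : ℝ := (Q : ℝ) ^ k with hE
    have hQ1 : (1 : ℝ) ≤ Q := by exact_mod_cast hQ
    have hE1 : 1 ≤ E := one_le_pow₀ hQ1
    set V : ℝ := ((9 * R (k + 1) : ℕ) : ℝ) ^ d with hV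
    have hVexp : V ≤ Real.exp (b * Q * E) := by
      refine (hR (k + 1)).trans_eq ?_
      rw [hE, pow_succ]
      congr 1
      ring
    have hV0 : 0 ≤ V := by positivity
    have hchoose : ∀ X : Finset (Site d), (X.card : ℝ) ≤ n * V →
        ((X.powersetCard n).card : ℝ) ≤ Real.exp (n * E * (1 + b * Q)) := by
      intro X hX
      rw [Finset.card_powersetCard]
      refine (choose_le_exp hX hVexp).trans (Real.exp_le_exp.mpr ?_)
      have : (n : ℝ) * 1 ≤ n * E := by gcongr
      nlinarith
    -- The 9 in V serves the terminal box too: 2 · 4R + 1 ≤ 9R.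
    have hboxV : ∀ (c : Site d) (ρ : ℕ), ρ ≤ 4 * R (k + 1) → ((box c ρ).card : ℝ) ≤ V := by
      intro c ρ hρ
      have := hR1 (k + 1)
      rw [card_box, hV]
      push_cast
      gcongr
      exact_mod_cast (by omega : 2 * ρ + 1 ≤ 9 * R (k + 1))
    set 𝓑 : ℕ → Finset (Finset (Site d)) := fun n' =>
      ((A n').filter fun S' => S'.card = n').biUnion fun S' =>
        (S'.biUnion fun s => box s (R (k + 1))).powersetCard n with h𝓑
    have h𝓑card : ∀ n' ∈ I, ((𝓑 n').card : ℝ) ≤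
        Real.exp ((2 + b * Q) / 2 * n * E) * Real.exp (n * E * (1 + b * Q)) := by
      intro n' hn'
      obtain ⟨hlt, hle⟩ := Finset.mem_filter.mp hn'
      rw [Finset.mem_range] at hlt
      -- The shrinking of the nets beats the growth of log R by a factor 8, so the coarser levels
      -- use at most an eighth of the exponent allowed for this one.
      have h8 : 8 * ((n' : ℝ) * Q) ≤ n := by
        have : 8 * (n' * Q) ≤ n :=
          le_trans (by linarith [Nat.mul_le_mul_right n' hQr]) hle
        exact_mod_cast this
      have hstep : ((𝓑 n').card : ℝ) ≤ (A n').card * Real.exp (n * E * (1 + b * Q)) := by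
        have h1 : ((𝓑 n').card : ℝ) ≤ ∑ S' ∈ (A n').filter (fun S' => S'.card = n'),
            (((S'.biUnion fun s => box s (R (k + 1))).powersetCard n).card : ℝ) := by
          exact_mod_cast Finset.card_biUnion_le
        refine h1.trans ?_
        have h2 : ∀ S' ∈ (A n').filter (fun S' => S'.card = n'),
            (((S'.biUnion fun s => box s (R (k + 1))).powersetCard n).card : ℝ) ≤
              Real.exp (n * E * (1 + b * Q)) := by
          intro S' hS'
          refine hchoose _ ?_
          have h3 : ((S'.biUnion fun s => box s (R (k + 1))).card : ℝ) ≤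
              ∑ s ∈ S', ((box s (R (k + 1))).card : ℝ) := by
            exact_mod_cast Finset.card_biUnion_le
          refine h3.trans ((Finset.sum_le_card_nsmul _ _ V fun s _ =>
            hboxV s _ (by omega)).trans ?_)
          rw [nsmul_eq_mul, (Finset.mem_filter.mp hS').2]
          gcongr
        refine (Finset.sum_le_card_nsmul _ _ _ h2).trans ?_
        rw [nsmul_eq_mul]
        gcongr
        exact Finset.filter_subset _ _
      refine hstep.trans (mul_le_mul_of_nonneg_right ((hAcard n' hlt).trans ?_)
        (Real.exp_nonneg _))
      refine Real.exp_le_exp.mpr ?_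
      have h0 : 0 ≤ (2 + b * Q) * E := by positivity
      calc 4 * (2 + b * Q) * n' * (Q : ℝ) ^ (k + 1)
          = (2 + b * Q) * E / 2 * (8 * (n' * Q)) := by rw [hE]; ring
        _ ≤ (2 + b * Q) * E / 2 * n := by gcongr
        _ = (2 + b * Q) / 2 * n * E := by ring
    refine ⟨(box 0 (4 * R (k + 1))).powersetCard n ∪ I.biUnion 𝓑, ?_, ?_⟩
    · have hnear : (((box (0 : Site d) (4 * R (k + 1))).powersetCard n).card : ℝ) ≤
          Real.exp (n * E * (1 + b * Q)) :=
        hchoose _ ((hboxV 0 _ le_rfl).trans (le_mul_of_one_le_left hV0 hn1))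
      set x : ℝ := Real.exp ((2 + b * Q) / 2 * n * E) with hx
      set y : ℝ := Real.exp (n * E * (1 + b * Q)) with hy
      have hx1 : 1 ≤ x := Real.one_le_exp (by positivity)
      have hcoarse : ((I.biUnion 𝓑).card : ℝ) ≤ n * (x * y) := by
        have h1 : ((I.biUnion 𝓑).card : ℝ) ≤ ∑ n' ∈ I, ((𝓑 n').card : ℝ) := by
          exact_mod_cast Finset.card_biUnion_le
        refine h1.trans ((Finset.sum_le_card_nsmul _ _ _ h𝓑card).trans ?_)
        rw [nsmul_eq_mul]
        gcongr
        exact (Finset.card_filter_le _ _).trans_eq (Finset.card_range n)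
      have hunion : (((box 0 (4 * R (k + 1))).powersetCard n ∪ I.biUnion 𝓑).card : ℝ) ≤
          ((box (0 : Site d) (4 * R (k + 1))).powersetCard n).card + (I.biUnion 𝓑).card := by
        exact_mod_cast Finset.card_union_le _ _
      calc (((box 0 (4 * R (k + 1))).powersetCard n ∪ I.biUnion 𝓑).card : ℝ)
          ≤ y + n * (x * y) := hunion.trans (add_le_add hnear hcoarse)
        _ ≤ x * y + n * (x * y) := by
            gcongr
            exact le_mul_of_one_le_left (Real.exp_nonneg _) hx1
        _ = (n + 1) * (x * y) := by ring
        -- The choice of the size n' of the coarser set is absorbed by e^n.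
        _ ≤ Real.exp n * (x * y) := by
            gcongr
            exact Real.add_one_le_exp _
        _ ≤ Real.exp (4 * (2 + b * Q) * n * E) := by
            rw [hx, hy, ← Real.exp_add, ← Real.exp_add]
            refine Real.exp_le_exp.mpr ?_
            have h1 : (n : ℝ) * 1 ≤ n * E := by gcongr
            have h2 : 0 ≤ b * Q * (n * E) := by positivity
            nlinarith
    · intro S hSn hS
      cases hS with
      | near h => exact Finset.mem_union_left _ (Finset.mem_powersetCard.mpr ⟨h, hSn⟩)
      | @coarsen _ _ S' hcard hsub h =>
        have hlt : S'.card < n := by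
          have : 8 * S'.card ≤ 2 ^ r * S'.card := Nat.mul_le_mul_right _ (by omega)
          omega
        refine Finset.mem_union_right _ (Finset.mem_biUnion.mpr ⟨S'.card, ?_, ?_⟩)
        · exact Finset.mem_filter.mpr ⟨Finset.mem_range.mpr hlt, hSn ▸ hcard⟩
        · exact Finset.mem_biUnion.mpr ⟨S', Finset.mem_filter.mpr ⟨hAmem _ hlt S' rfl h, rfl⟩,
            Finset.mem_powersetCard.mpr ⟨hsub, hSn⟩⟩

/-! ### An indecomposable boundary around the origin is multiscale -/

/-- A half-axis from the origin that missed γ would put the origin in the unbounded component. -/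
lemma exists_single_mem_of_zero_mem_volume {γ : Finset (Site d)}
    (h0 : (0 : Site d) ∈ volume (γ : Set (Site d))) (i : Fin d) {e : ℤ} (he : e = 1 ∨ e = -1) :
    ∃ n : ℕ, Pi.single i (e * n) ∈ γ := by
  by_contra! hcon
  refine h0 ?_
  have hinj : Function.Injective fun n : ℕ => (Pi.single i (e * n) : Site d) := by
    intro m n hmn
    have := congrFun hmn i
    simp only [Pi.single_eq_same] at this
    rcases he with rfl | rfl <;> omega
  refine (Set.infinite_range_of_injective hinj).mono ?_
  rintro _ ⟨n, rfl⟩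
  refine mem_componentOf_of_box _ _ fun z hz hzγ => ?_
  have hzi := hz i
  simp only [Pi.single_eq_same, Pi.zero_apply, Set.mem_uIcc] at hzi
  refine hcon (e * z i).toNat ?_
  have : z = Pi.single i (e * (e * z i).toNat) := by
    ext j
    by_cases hj : j = i
    · subst hj
      rw [Pi.single_eq_same]
      rcases he with rfl | rfl <;> omega
    · have := hz j
      simp only [Pi.single_eq_of_ne hj, Pi.zero_apply, Set.uIcc_self, Set.mem_singleton_iff] at this
      rw [Pi.single_eq_of_ne hj, this]
  rwa [← this]

/-- γ meets both halves of one axis, and these two points are at most 2ρ apart. Both are then within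
2ρ of the origin, and every point of γ is within 2ρ of them. -/
lemma subset_box_of_zero_mem_volume {γ : Finset (Site d)} (hd : 0 < d)
    (h0 : (0 : Site d) ∈ volume (γ : Set (Site d))) {c : Site d} {ρ : ℕ}
    (hc : ∀ x ∈ γ, l1dist c x ≤ ρ) : γ ⊆ box 0 (4 * ρ) := by
  obtain ⟨u, hu⟩ := exists_single_mem_of_zero_mem_volume h0 ⟨0, hd⟩ (Or.inl rfl)
  obtain ⟨v, hv⟩ := exists_single_mem_of_zero_mem_volume h0 ⟨0, hd⟩ (Or.inr rfl)
  have hdist : ∀ x ∈ γ, ∀ y ∈ γ, l1dist x y ≤ 2 * ρ := fun x hx y hy => by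
    have h1 := l1dist_triangle x c y
    rw [l1dist_comm x c] at h1
    have h2 := hc x hx
    have h3 := hc y hy
    omega
  have huv := (natAbs_le_l1dist _ _ ⟨0, hd⟩).trans (hdist _ hu _ hv)
  simp only [Pi.single_eq_same] at huv
  intro x hx
  refine mem_box.mpr fun i => ?_
  have h1 := (natAbs_le_l1dist _ _ i).trans (hdist _ hx _ hu)
  simp only [Pi.zero_apply]
  by_cases hi : i = ⟨0, hd⟩
  · subst hi
    simp only [Pi.single_eq_same] at h1
    omega
  · rw [Pi.single_eq_of_ne hi] at h1
    omega

lemma box_mono {c : Site d} {R R' : ℕ} (h : R ≤ R') : box c R ⊆ box c R' :=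
  fun _ hx => mem_box.mpr fun i => (mem_box.mp hx i).trans h

/-- Coarsening strictly decreases the cardinality of the net, so the tower ends, and it can only end
with γ inside a single ball. -/
lemma IsIndecomposable.isMultiscale {M a : ℝ} {r : ℕ} {γ : Finset (Site d)}
    (hγ : IsIndecomposable M a r γ) (hd : 2 ≤ d) (hM : 0 ≤ M) (ha : 0 ≤ a) (hr : 1 ≤ r)
    (h0 : (0 : Site d) ∈ volume (γ : Set (Site d))) {R t : ℕ → ℕ} (hR : ∀ k, 1 ≤ R k)
    (hDt : ∀ k, M * ((2 * R k : ℕ) : ℝ) ^ a < t k + 1)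
    (ht : ∀ k, 2 ^ r * (2 * R k + 1) ≤ t k)
    (hgrow : ∀ k, 2 * (2 ^ r * (t k + 2 * R k + 1)) ≤ R (k + 1))
    {S : Finset (Site d)} {k : ℕ} (hSγ : S ⊆ γ) (hS : ∀ x ∈ γ, ∃ s ∈ S, l1dist x s ≤ R k) :
    IsMultiscale r R k S := by
  induction hn : S.card using Nat.strong_induction_on generalizing S k with
  | _ n ih =>
    by_cases hout : ∀ c ∈ γ, ∃ x ∈ γ, 2 ^ r * (t k + 2 * R k + 1) < l1dist c x
    · obtain ⟨S', hS'γ, hcard, hnet⟩ :=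
        hγ.exists_coarser_net hd hM ha hr (hR k) hS (hDt k) (ht k) hout
      have hnet' : ∀ x ∈ γ, ∃ s ∈ S', l1dist x s ≤ R (k + 1) := fun x hx => by
        obtain ⟨s, hs, hxs⟩ := hnet x hx
        exact ⟨s, hs, hxs.trans (hgrow k)⟩
      refine IsMultiscale.coarsen hcard (fun x hx => ?_) ?_
      · obtain ⟨s, hs, hxs⟩ := hnet' x (hSγ hx)
        exact Finset.mem_biUnion.mpr ⟨s, hs, mem_box_of_l1dist_le hxs⟩
      · refine ih S'.card ?_ hS'γ hnet' rfl
        have hγne : γ.Nonempty := by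
          obtain ⟨u, hu⟩ := exists_single_mem_of_zero_mem_volume h0 ⟨0, by omega⟩ (Or.inl rfl)
          exact ⟨_, hu⟩
        obtain ⟨x, hx⟩ := hγne
        obtain ⟨s, hs, -⟩ := hnet x hx
        have hpos : 0 < S'.card := Finset.card_pos.mpr ⟨s, hs⟩
        have hpow : 2 ^ 1 ≤ 2 ^ r := Nat.pow_le_pow_right (by norm_num) hr
        have := Nat.mul_le_mul_right S'.card hpow
        omega
    · push Not at hout
      obtain ⟨c, -, hc⟩ := hout
      refine IsMultiscale.near (hSγ.trans
        ((subset_box_of_zero_mem_volume (by omega) h0 hc).trans (box_mono ?_)))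
      have := hgrow k
      omega

/-! ### The scales -/

/-- Scales growing like an iterated power dominate the separation thresholds. -/
lemma scale_bounds {M a : ℝ} (hM : 0 < M) {r Q R : ℕ} (ha : 3 ≤ a) (haQ : a + 1 ≤ Q)
    (hRM : (2 : ℝ) ^ (r + 1) / M ≤ R) (hRQ : (2 : ℝ) ^ (r + 1) * (M * 2 ^ Q + 3) ≤ R)
    (hR : 1 ≤ R) :
    2 ^ r * (2 * R + 1) ≤ ⌊M * ((2 * R : ℕ) : ℝ) ^ a⌋₊ ∧
      2 * (2 ^ r * (⌊M * ((2 * R : ℕ) : ℝ) ^ a⌋₊ + 2 * R + 1)) ≤ R ^ Q := by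
  have hR1 : (1 : ℝ) ≤ R := by exact_mod_cast hR
  have hR2 : (1 : ℝ) ≤ 2 * R := by linarith
  push_cast
  have hQ4 : 4 ≤ Q := by
    have : (4 : ℝ) ≤ Q := by linarith
    exact_mod_cast this
  obtain ⟨q, rfl⟩ : ∃ q, Q = q + 1 := ⟨Q - 1, by omega⟩
  -- Comparison with integer powers on both sides: the cube dominates the linear lower threshold,
  -- and a ≤ Q - 1 leaves one factor R to absorb the constants.
  have hlow : (2 * R : ℝ) ^ 3 ≤ (2 * R : ℝ) ^ a := by
    rw [← Real.rpow_natCast]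
    exact Real.rpow_le_rpow_of_exponent_le hR2 (by exact_mod_cast ha)
  have hupp : (2 * R : ℝ) ^ a ≤ (2 * R : ℝ) ^ q := by
    rw [← Real.rpow_natCast]
    refine Real.rpow_le_rpow_of_exponent_le hR2 ?_
    push_cast at haQ
    linarith
  have hp : (0 : ℝ) < 2 ^ r := by positivity
  constructor
  · refine Nat.le_floor ?_
    push_cast
    rw [div_le_iff₀ hM, pow_succ] at hRM
    have h1 : M * (2 * R : ℝ) ^ 3 ≤ M * (2 * R : ℝ) ^ a := mul_le_mul_of_nonneg_left hlow hM.le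
    refine le_trans ?_ h1
    have h2 : (2 : ℝ) ^ r * (2 * R + 1) ≤ 2 ^ r * (4 * R) := by gcongr; linarith
    have h3 : (2 : ℝ) ^ r * 2 * (8 * R ^ 2) ≤ R * M * (8 * R ^ 2) := by gcongr
    have h4 : (2 : ℝ) ^ r * (4 * R) ≤ 2 ^ r * 2 * (8 * R ^ 2) := by
      have : (R : ℝ) ≤ R ^ 2 := by nlinarith
      nlinarith
    linarith [show R * M * (8 * (R : ℝ) ^ 2) = M * (2 * R : ℝ) ^ 3 by ring]
  · have hfl : (⌊M * (2 * R : ℝ) ^ a⌋₊ : ℝ) ≤ M * (2 ^ (q + 1) * R ^ q) := by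
      refine (Nat.floor_le (by positivity)).trans (mul_le_mul_of_nonneg_left (hupp.trans ?_) hM.le)
      rw [mul_pow]
      gcongr
      · norm_num
      · omega
    have hRq : (R : ℝ) ≤ R ^ q := le_self_pow₀ hR1 (by omega)
    have : (2 : ℝ) * (2 ^ r * (⌊M * (2 * R : ℝ) ^ a⌋₊ + 2 * R + 1)) ≤ R ^ (q + 1) := by
      calc (2 : ℝ) * (2 ^ r * (⌊M * (2 * R : ℝ) ^ a⌋₊ + 2 * R + 1))
          ≤ 2 * (2 ^ r * (M * (2 ^ (q + 1) * R ^ q) + 2 * R ^ q + R ^ q)) := by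
            gcongr
            exact hR1.trans hRq
        _ = 2 ^ (r + 1) * (M * 2 ^ (q + 1) + 3) * R ^ q := by ring
        _ ≤ R * R ^ q := by gcongr
        _ = R ^ (q + 1) := by ring
    exact_mod_cast this

lemma three_le_contourExponent (hd : 2 ≤ d) {α ε : ℝ} (hε : 0 < ε) :
    3 ≤ contourExponent d α ε := by
  refine le_trans ?_ (le_max_right _ _)
  have : (2 : ℝ) ≤ d := by exact_mod_cast hd
  linarith

/-- The summand d + 1 ≥ 3 in r leaves a spare factor 8 between 2^r and a power of two that is at
least a + 1. -/
lemma add_one_le_two_pow_contourR (hd : 2 ≤ d) {a : ℝ} (ha : 0 < a) :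
    3 ≤ contourR d a ∧ a + 1 ≤ ((2 ^ (contourR d a - 3) : ℕ) : ℝ) := by
  refine ⟨by unfold contourR; omega, ?_⟩
  have h1 : a + 1 ≤ (2 : ℝ) ^ ⌈Real.logb 2 (a + 1)⌉₊ := by
    rw [← Real.rpow_natCast, ← Real.logb_le_iff_le_rpow (by norm_num) (by linarith)]
    exact Nat.le_ceil _
  refine h1.trans ?_
  push_cast
  exact pow_le_pow_right₀ (by norm_num) (by unfold contourR; omega)

/-- The supports of the family are the parts of the finest partition, which thus has one part, and
that part lies in a part of any other partition. -/
lemma isIndecomposable_of_mem_externalFamilies {M a : ℝ} {r : ℕ} {s : ℤˣ} {Λ : Finset (Site d)}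
    {γ : Contour d} (h : {γ} ∈ externalFamilies M a r s Λ) :
    IsIndecomposable M a r γ.support := by
  obtain ⟨-, ⟨σ, -, Γ, hΓ, hbij, -⟩, -⟩ := h
  have himg := hbij.image_eq
  rw [Set.image_singleton] at himg
  have hΓ' : Γ = {γ.support} := by
    ext A
    rw [← Finset.mem_coe, ← himg]
    simp
  subst hΓ'
  refine ⟨σ, ?_, fun Γ' hΓ' => hΓ.2 Γ' hΓ' _ (by simp)⟩
  rw [← hΓ.1.union_eq]
  simp

end LongRangeIsing

open LongRangeIsing

theorem proposition3p14 (d : ℕ) (hd : 2 ≤ d) (M : ℝ) (hM : 0 < M) (r : ℕ) :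
    ∃ c₁ : ℝ, 0 < c₁ ∧
      ∀ α ε a : ℝ, (d : ℝ) < α → 0 < ε →
        a = LongRangeIsing.contourExponent d α ε →
        r = LongRangeIsing.contourR d a →
        ∀ (Λ : Finset (LongRangeIsing.Site d)) (m : ℕ), 1 ≤ m →
          (LongRangeIsing.contourSupports M a r Λ m).Finite ∧
          ((LongRangeIsing.contourSupports M a r Λ m).ncard : ℝ) ≤ Real.exp (c₁ * m) := by
  -- Q and the initial scale B depend on M and r only; bounding a by Q is what keeps the constant
  -- free of α, ε and a.
  set Q : ℕ := 2 ^ (r - 3) with hQ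
  set B : ℕ := max 1 (max ⌈(2 : ℝ) ^ (r + 1) / M⌉₊ ⌈(2 : ℝ) ^ (r + 1) * (M * 2 ^ Q + 3)⌉₊) with hB
  set b : ℝ := d * Real.log (9 * B) with hb
  have hB1 : 1 ≤ B := le_max_left _ _
  have hB1' : (1 : ℝ) ≤ B := by exact_mod_cast hB1
  have hb0 : 0 ≤ b := mul_nonneg (Nat.cast_nonneg _) (Real.log_nonneg (by linarith))
  refine ⟨4 * (2 + b * Q), by positivity, ?_⟩
  intro α ε a hα hε ha hr Λ m hm
  have ha3 : 3 ≤ a := ha ▸ three_le_contourExponent hd hε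
  obtain ⟨hr3, haQ⟩ := add_one_le_two_pow_contourR hd (a := a) (by linarith)
  rw [← hr] at hr3 haQ
  have hQ1 : 1 ≤ Q := Nat.one_le_two_pow
  have hQr : 8 * Q ≤ 2 ^ r := by
    obtain ⟨k, rfl⟩ : ∃ k, r = k + 3 := ⟨r - 3, by omega⟩
    rw [hQ, Nat.add_sub_cancel, pow_add]
    omega
  set R : ℕ → ℕ := fun k => B ^ Q ^ k with hRdef
  have hRB : ∀ k, B ≤ R k := fun k => Nat.le_self_pow (pow_ne_zero _ (by omega)) B
  have hR1 : ∀ k, 1 ≤ R k := fun k => hB1.trans (hRB k)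
  have hRsucc : ∀ k, R (k + 1) = R k ^ Q := fun k => by
    simp only [hRdef]
    rw [pow_succ Q, pow_mul]
  have hRexp : ∀ k, ((9 * R k : ℕ) : ℝ) ^ d ≤ Real.exp (b * Q ^ k) := by
    intro k
    have hle : ((9 * R k : ℕ) : ℝ) ≤ (9 * B : ℝ) ^ Q ^ k := by
      simp only [hRdef]
      push_cast
      rw [mul_pow]
      gcongr
      exact le_self_pow₀ (by norm_num) (pow_ne_zero _ (by omega))
    calc ((9 * R k : ℕ) : ℝ) ^ d ≤ ((9 * B : ℝ) ^ Q ^ k) ^ d := by gcongr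
      _ = Real.exp (b * Q ^ k) := by
        rw [← Real.exp_log (show (0 : ℝ) < 9 * B by linarith), ← Real.exp_nat_mul,
          ← Real.exp_nat_mul, hb]
        congr 1
        push_cast
        ring
  have hbounds := fun k => scale_bounds (r := r) (Q := Q) (R := R k) hM ha3 haQ
    ((Nat.le_ceil _).trans (by
      exact_mod_cast ((le_max_left _ _).trans (le_max_right _ _)).trans (hRB k)))
    ((Nat.le_ceil _).trans (by
      exact_mod_cast ((le_max_right _ _).trans (le_max_right _ _)).trans (hRB k))) (hR1 k)
  obtain ⟨𝓐, hcard, hmem⟩ := exists_finset_isMultiscale (d := d) hQ1 hQr hb0 hR1 hRexp m 0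
  have hsub : contourSupports M a r Λ m ⊆ (𝓐 : Set (Finset (Site d))) := by
    rintro _ ⟨γ, rfl, hγ, h0, hγm⟩
    refine hmem _ hγm ?_
    -- The tower starts at level 0 with the support as its own net; the thresholds t are the integer
    -- parts of M(2R)^a.
    refine (isIndecomposable_of_mem_externalFamilies hγ).isMultiscale hd hM.le (by linarith)
      (by omega) h0 (t := fun k => ⌊M * ((2 * R k : ℕ) : ℝ) ^ a⌋₊) hR1
      (fun k => Nat.lt_floor_add_one _) (fun k => (hbounds k).1)
      (fun k => (hbounds k).2.trans_eq (hRsucc k).symm) subset_rfl fun x hx => ⟨x, hx, ?_⟩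
    rw [l1dist_self]
    omega
  refine ⟨𝓐.finite_toSet.subset hsub, ?_⟩
  calc ((contourSupports M a r Λ m).ncard : ℝ) ≤ (𝓐 : Set (Finset (Site d))).ncard := by
        exact_mod_cast Set.ncard_le_ncard hsub 𝓐.finite_toSet
    _ = 𝓐.card := by rw [Set.ncard_coe_finset]
    _ ≤ _ := by simpa using hcard
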